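/- Let $P_1,P_2>0$. For $n\ge 1$ let $X_1,X_2,Z$ be independent random vectors in $\mathbb R^n$, where $X_i$ is uniformly distributed on the power shell $\{x\in\mathbb R^n:\|x\|^2=nP_i\}$ for $i=1,2$, and $Z\sim\mathcal N(0,I_n)$. Let $Y=X_1+X_2+Z$ be the output of the Gaussian multiple access channel, whose transition density is $P_{Y|X_1X_2}(y|x_1,x_2)=(2\pi)^{-n/2}e^{-\|y-x_1-x_2\|^2/2}$. For $x_1,x_2\in\mathbb R^n$ let $P_{Y|X_2=x_2}$ be the law of $X_1+x_2+Z$, let $P_{Y|X_1=x_1}$ be the law of $x_1+X_2+Z$, and let $P_Y$ be the law of $Y$; denote their densities, obtained by averaging the transition density over the random inputs, by $$p(y|x_2)=\mathbb E\,P_{Y|X_1X_2}(y|X_1,x_2),\quad p(y|x_1)=\mathbb E\,P_{Y|X_1X_2}(y|x_1,X_2),\quad p(y)=\mathbb E\,P_{Y|X_1X_2}(y|X_1,X_2).$$ Let $Q^{(1)}_{x_2}=\mathcal N(x_2,(1+P_1)I_n)$, $Q^{(2)}_{x_1}=\mathcal N(x_1,(1+P_2)I_n)$ and $Q^{(3)}=\mathcal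 N(0,(1+P_1+P_2)I_n)$, with densities $q^{(1)}(y|x_2)$, $q^{(2)}(y|x_1)$ and $q^{(3)}(y)$. Then there exist constants $K_1,K_2,K_3>0$, which depend on $P_1,P_2$ but not on $n$, such that for all sufficiently large $n$ and all $x_1,x_2\in\mathbb R^n$: the laws $P_{Y|X_2=x_2}$, $P_{Y|X_1=x_1}$ and $P_Y$ are absolutely continuous with respect to $Q^{(1)}_{x_2}$, $Q^{(2)}_{x_1}$ and $Q^{(3)}$ respectively, their Radon–Nikodym derivatives are given by the ratios of the densities, and for every $y\in\mathbb R^n$ $$\frac{dP_{Y|X_2=x_2}}{dQ^{(1)}_{x_2}}(y)=\frac{p(y|x_2)}{q^{(1)}(y|x_2)}\le K_1,\qquad \frac{dP_{Y|X_1=x_1}}{dQ^{(2)}_{x_1}}(y)=\frac{p(y|x_1)}{q^{(2)}(y|x_1)}\le K_2,\qquad \frac{dP_Y}{dQ^{(3)}}(y)=\frac{p(y)}{q^{(3)}(y)}\le K_3.$$ How large $n$ has to be depends only on $P_1,P_2$, not on $x_1,x_2,y$. -/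

import Mathlib

open MeasureTheory ProbabilityTheory Filter

noncomputable section

namespace GaussianMAC

/-- The space `ℝⁿ` with its Euclidean norm. -/
abbrev Vec (n : ℕ) : Type := EuclideanSpace ℝ (Fin n)

/-- The density at `y` of the Gaussian distribution `𝒩(m, v Iₙ)`. -/
def gaussianDensity {n : ℕ} (m : Vec n) (v : ℝ) (y : Vec n) : ℝ :=
  (2 * Real.pi * v) ^ (-(n : ℝ) / 2) * Real.exp (-‖y - m‖ ^ 2 / (2 * v))

/-- The Gaussian distribution `𝒩(m, v Iₙ)`. -/
def gaussianLaw {n : ℕ} (m : Vec n) (v : ℝ) : Measure (Vec n) :=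
  multivariateGaussian m (v • (1 : Matrix (Fin n) (Fin n) ℝ))

/-- The uniform distribution on the power shell `{x ∈ ℝⁿ : ‖x‖² = n P}`: the normalised surface
measure of the unit sphere, scaled by the radius `√(n P)`. -/
def powerShell (n : ℕ) (P : ℝ) : Measure (Vec n) :=
  (((volume : Measure (Vec n)).toSphere Set.univ)⁻¹ • (volume : Measure (Vec n)).toSphere).map
    (fun s : Metric.sphere (0 : Vec n) 1 => Real.sqrt (n * P) • (s : Vec n))

/-- The transition density `P_{Y|X₁X₂}(y | x₁, x₂)` of the Gaussian multiple access channel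
`Y = X₁ + X₂ + Z`, with `Z ∼ 𝒩(0, Iₙ)`. -/
def channelDensity {n : ℕ} (x₁ x₂ y : Vec n) : ℝ := gaussianDensity (x₁ + x₂) 1 y

/-- The conditional output distribution `P_{Y|X₂ = x₂}`, that is, the law of `X₁ + x₂ + Z` for
independent `X₁` (uniform on the power shell of power `P₁`) and `Z ∼ 𝒩(0, Iₙ)`. -/
def outputLawGivenX₂ {n : ℕ} (P₁ : ℝ) (x₂ : Vec n) : Measure (Vec n) :=
  ((powerShell n P₁).prod (gaussianLaw 0 1)).map (fun p => p.1 + x₂ + p.2)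

/-- The conditional output distribution `P_{Y|X₁ = x₁}`, that is, the law of `x₁ + X₂ + Z` for
independent `X₂` (uniform on the power shell of power `P₂`) and `Z ∼ 𝒩(0, Iₙ)`. -/
def outputLawGivenX₁ {n : ℕ} (P₂ : ℝ) (x₁ : Vec n) : Measure (Vec n) :=
  ((powerShell n P₂).prod (gaussianLaw 0 1)).map (fun p => x₁ + p.1 + p.2)

/-- The output distribution `P_Y`, that is, the law of `X₁ + X₂ + Z` for independent `X₁`, `X₂`
(uniform on the respective power shells) and `Z ∼ 𝒩(0, Iₙ)`. -/
def outputLaw (n : ℕ) (P₁ P₂ : ℝ) : Measure (Vec n) :=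
  (((powerShell n P₁).prod (powerShell n P₂)).prod (gaussianLaw 0 1)).map
    (fun p => p.1.1 + p.1.2 + p.2)

/-- The density of `P_{Y|X₂ = x₂}` at `y`. -/
def outputDensityGivenX₂ {n : ℕ} (P₁ : ℝ) (x₂ y : Vec n) : ℝ :=
  ∫ x₁, channelDensity x₁ x₂ y ∂(powerShell n P₁)

/-- The density of `P_{Y|X₁ = x₁}` at `y`. -/
def outputDensityGivenX₁ {n : ℕ} (P₂ : ℝ) (x₁ y : Vec n) : ℝ :=
  ∫ x₂, channelDensity x₁ x₂ y ∂(powerShell n P₂)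

/-- The density of `P_Y` at `y`. -/
def outputDensity {n : ℕ} (P₁ P₂ : ℝ) (y : Vec n) : ℝ :=
  ∫ x₁, ∫ x₂, channelDensity x₁ x₂ y ∂(powerShell n P₂) ∂(powerShell n P₁)

/-- `P` is absolutely continuous with respect to `Q`, the function `D` is a version of the
Radon–Nikodym derivative `dP/dQ`, and `D y ≤ K` at every single point `y`. -/
def DerivBoundedBy {n : ℕ} (P Q : Measure (Vec n)) (D : Vec n → ℝ) (K : ℝ) : Prop :=
  P ≪ Q ∧ (P.rnDeriv Q =ᵐ[Q] fun y => ENNReal.ofReal (D y)) ∧ ∀ y, D y ≤ K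

end GaussianMAC

end

/-!
A power shell is nearly as spread out as the Gaussian `𝒩(0, P Iₙ)`. In polar coordinates, that
Gaussian is a mixture of uniform distributions on spheres, the radius having density proportional
to `r ^ (n - 1) * exp (-r ^ 2 / (2 P))`. This radial density is concentrated in a window of constant
width around the shell radius `R = √(n P)`: it is at most a constant times its value at `R` times a
Gaussian profile (`radialWeight_le`), and at least a constant times its value at `R` on
`[R - 1, R + 1]` (`le_radialWeight`). Being normalised, it therefore puts mass at least a constant
times `|I|` on any interval `I` contained in `[R - 1, R + 1]`.

It remains to compare, after adding noise `𝒩(0, v Iₙ)`, the shell of radius `R` with the shells of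
radius `R ± t`. Neither of these two alone can dominate it uniformly in the output `y`, but their
sum does, pointwise on the sphere: by the parallelogram law and `exp u + exp (-u) ≥ 2`, the
densities at `y` of the Gaussians centred at `(R + t) s` and `(R - t) s` sum to at least
`2 exp (-1 / (2 v))` times the one centred at `R s` (`gaussianDensity_midpoint_le`). Integrating
over `t` and `s` bounds the density of shell plus noise by a constant times the density of
`𝒩(0, P Iₙ) ∗ 𝒩(0, v Iₙ) = 𝒩(0, (v + P) Iₙ)` (`exists_lintegral_powerShell_le`).

The two conditional bounds are the case `v = 1`. For the sum of both inputs, the case `v = 1` first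
replaces `X₂ + Z` by a Gaussian of variance `1 + P₂`, and the case `v = 1 + P₂` then handles `X₁`.
The densities are identified with Radon–Nikodym derivatives by Tonelli's theorem
(`map_add_gaussianLaw`, `derivBoundedBy_of_withDensity`).
-/

namespace GaussianMAC

variable {n : ℕ}

/-! ### Gaussian densities -/

lemma gaussianDensity_pos (m : Vec n) {v : ℝ} (hv : 0 < v) (y : Vec n) :
    0 < gaussianDensity m v y := by
  unfold gaussianDensity; positivity

@[fun_prop]
lemma measurable_gaussianDensity {α : Type*} [MeasurableSpace α] {f g : α → Vec n}
    (hf : Measurable f) (hg : Measurable g) (v : ℝ) :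
    Measurable fun a => gaussianDensity (f a) v (g a) := by
  unfold gaussianDensity; fun_prop

lemma gaussianDensity_sub (m a : Vec n) (v : ℝ) (y : Vec n) :
    gaussianDensity m v (y - a) = gaussianDensity (m + a) v y := by
  simp only [gaussianDensity, show y - a - m = y - (m + a) by abel]

lemma gaussianDensity_le (m : Vec n) {v : ℝ} (hv : 0 < v) (y : Vec n) :
    gaussianDensity m v y ≤ (2 * Real.pi * v) ^ (-(n : ℝ) / 2) := by
  unfold gaussianDensity
  refine mul_le_of_le_one_right (by positivity) (Real.exp_le_one_iff.2 ?_)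
  exact div_nonpos_of_nonpos_of_nonneg (by simp) (by positivity)

lemma integral_gaussianDensity (m : Vec n) {v : ℝ} (hv : 0 < v) :
    ∫ x, gaussianDensity m v x = 1 := by
  unfold gaussianDensity
  rw [integral_const_mul, integral_sub_right_eq_self
    (fun x : Vec n => Real.exp (-‖x‖ ^ 2 / (2 * v))) m]
  have h := GaussianFourier.integral_rexp_neg_mul_sq_norm (V := Vec n)
    (b := 1 / (2 * v)) (by positivity)
  simp only [finrank_euclideanSpace, Fintype.card_fin] at h
  have e : (fun x : Vec n => Real.exp (-‖x‖ ^ 2 / (2 * v))) =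
      fun x => Real.exp (-(1 / (2 * v)) * ‖x‖ ^ 2) := by
    ext x; congr 1; ring
  rw [e, h, show Real.pi / (1 / (2 * v)) = 2 * Real.pi * v by field_simp,
    ← Real.rpow_add (by positivity)]
  simp [neg_div]

lemma integrable_gaussianDensity (m : Vec n) {v : ℝ} (hv : 0 < v) :
    Integrable (gaussianDensity m v) :=
  .of_integral_ne_zero (by simp [integral_gaussianDensity m hv])

lemma lintegral_gaussianDensity (m : Vec n) {v : ℝ} (hv : 0 < v) :
    ∫⁻ x, ENNReal.ofReal (gaussianDensity m v x) = 1 := by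
  rw [← ofReal_integral_eq_lintegral_ofReal (integrable_gaussianDensity m hv)
    (ae_of_all _ fun x => (gaussianDensity_pos m hv x).le), integral_gaussianDensity m hv,
    ENNReal.ofReal_one]

/-- `gaussianDensity` is the Lebesgue density of `gaussianLaw`: both measures have the same
characteristic function. -/
lemma gaussianLaw_eq_withDensity (m : Vec n) {v : ℝ} (hv : 0 < v) :
    gaussianLaw m v = volume.withDensity fun x => ENNReal.ofReal (gaussianDensity m v x) := by
  have hm : Measurable fun x => gaussianDensity m v x := by fun_prop
  have hfin : IsFiniteMeasure
      ((volume : Measure (Vec n)).withDensity fun x => ENNReal.ofReal (gaussianDensity m v x)) :=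
    ⟨by simp [lintegral_gaussianDensity m hv]⟩
  have : IsFiniteMeasure (gaussianLaw m v) := by unfold gaussianLaw; infer_instance
  refine Measure.ext_of_charFun ?_
  ext t
  have hS : (v • (1 : Matrix (Fin n) (Fin n) ℝ)).PosSemidef := Matrix.PosSemidef.one.smul hv.le
  rw [gaussianLaw, charFun_multivariateGaussian hS, charFun_apply,
    integral_withDensity_eq_integral_toReal_smul (by fun_prop) (by simp)]
  simp only [ENNReal.toReal_ofReal (gaussianDensity_pos m hv _).le]
  rw [← integral_add_right_eq_self _ m]
  have hb : 0 < ((1 / (2 * v) : ℝ) : ℂ).re := by rw [Complex.ofReal_re]; positivity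
  have h := GaussianFourier.integral_cexp_neg_mul_sq_norm_add (V := Vec n) hb Complex.I t
  have hC : ((2 * Real.pi * v) ^ (-(n : ℝ) / 2) : ℝ) *
      ((Real.pi / ((1 / (2 * v) : ℝ) : ℂ)) ^ ((Module.finrank ℝ (Vec n) : ℂ) / 2)) = 1 := by
    rw [show (Real.pi / ((1 / (2 * v) : ℝ) : ℂ)) = ((2 * Real.pi * v : ℝ) : ℂ) by
      push_cast; field_simp]
    rw [show ((Module.finrank ℝ (Vec n) : ℂ) / 2) = (((n : ℝ) / 2 : ℝ) : ℂ) by simp,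
      ← Complex.ofReal_cpow (by positivity), ← Complex.ofReal_mul,
      ← Real.rpow_add (by positivity)]
    simp [neg_div]
  have e : ∀ x : Vec n, gaussianDensity m v (x + m) •
        Complex.exp ((inner ℝ (x + m) t : ℝ) * Complex.I) =
      ((((2 * Real.pi * v) ^ (-(n : ℝ) / 2) : ℝ) : ℂ) *
        Complex.exp ((inner ℝ t m : ℝ) * Complex.I)) *
        Complex.exp (-((1 / (2 * v) : ℝ) : ℂ) * (‖x‖ : ℂ) ^ 2 + Complex.I * (inner ℝ t x : ℝ)) := by
    intro x
    rw [gaussianDensity, add_sub_cancel_right, inner_add_left, real_inner_comm t x,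
      real_inner_comm t m, Complex.real_smul, Complex.ofReal_mul, Complex.ofReal_exp,
      mul_assoc (Complex.ofReal _), ← Complex.exp_add, mul_assoc (Complex.ofReal _),
      ← Complex.exp_add]
    congr 2
    push_cast
    field_simp
    ring
  simp_rw [e]
  rw [integral_const_mul, h]
  rw [show ∀ a b c d : ℂ, a * b * (c * d) = (a * c) * (b * d) by intros; ring, hC, one_mul,
    ← Complex.exp_add]
  congr 1
  rw [Matrix.smul_mulVec, Matrix.one_mulVec, dotProduct_smul, smul_eq_mul]
  have : (t.ofLp ⬝ᵥ t.ofLp : ℝ) = ‖t‖ ^ 2 := by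
    rw [EuclideanSpace.real_norm_sq_eq]; simp [dotProduct, sq]
  rw [this]
  push_cast
  simp only [Complex.I_sq]
  field_simp
  ring

/-- Completing the square: the product of two Gaussian densities splits as the density of the sum
times the conditional density of the first summand given the sum. -/
lemma gaussianDensity_mul_gaussianDensity {a b : ℝ} (ha : 0 < a) (hb : 0 < b) (x y : Vec n) :
    gaussianDensity 0 a x * gaussianDensity x b y =
      gaussianDensity 0 (b + a) y *
        gaussianDensity ((a / (a + b)) • y) (a * b / (a + b)) x := by
  have hab : 0 < a + b := by positivity
  have hn : ∀ (c : ℝ), ‖x - c • y‖ ^ 2 = ‖x‖ ^ 2 - 2 * c * inner ℝ x y + c ^ 2 * ‖y‖ ^ 2 := by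
    intro c
    rw [norm_sub_sq_real, inner_smul_right, norm_smul, mul_pow, Real.norm_eq_abs, sq_abs]; ring
  have hy : ‖y - x‖ ^ 2 = ‖x‖ ^ 2 - 2 * inner ℝ x y + ‖y‖ ^ 2 := by
    rw [norm_sub_rev]; simpa using hn 1
  unfold gaussianDensity
  simp only [sub_zero, hn, hy]
  rw [mul_mul_mul_comm, mul_mul_mul_comm ((2 * Real.pi * (b + a)) ^ _),
    ← Real.mul_rpow (by positivity) (by positivity),
    ← Real.mul_rpow (by positivity) (by positivity), ← Real.exp_add, ← Real.exp_add]
  congr 2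
  · field_simp
    ring
  · field_simp
    ring

/-- `𝒩(0, a Iₙ) ∗ 𝒩(0, b Iₙ) = 𝒩(0, (b + a) Iₙ)`, at the level of densities. -/
lemma lintegral_gaussianDensity_mul {a b : ℝ} (ha : 0 < a) (hb : 0 < b) (y : Vec n) :
    ∫⁻ x, ENNReal.ofReal (gaussianDensity 0 a x) * ENNReal.ofReal (gaussianDensity x b y) =
      ENNReal.ofReal (gaussianDensity 0 (b + a) y) := by
  have hab : 0 < a * b / (a + b) := by positivity
  simp_rw [← ENNReal.ofReal_mul (gaussianDensity_pos 0 ha _).le,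
    gaussianDensity_mul_gaussianDensity ha hb,
    ENNReal.ofReal_mul (gaussianDensity_pos (0 : Vec n) (add_pos hb ha) y).le]
  rw [lintegral_const_mul' _ _ ENNReal.ofReal_ne_top, lintegral_gaussianDensity _ hab, mul_one]

/-! ### Polar coordinates and the power shell -/

/-- Integration in polar coordinates. -/
lemma lintegral_eq_lintegral_toSphere (hn : n ≠ 0) {f : Vec n → ENNReal} (hf : Measurable f) :
    ∫⁻ x, f x = ∫⁻ s, (∫⁻ r in Set.Ioi (0 : ℝ),
      ENNReal.ofReal (r ^ (n - 1)) * f (r • (s : Vec n))) ∂(volume : Measure (Vec n)).toSphere := by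
  have : NeZero n := ⟨hn⟩
  have hmp := (volume : Measure (Vec n)).measurePreserving_homeomorphUnitSphereProd
  have hg : Measurable fun p : Metric.sphere (0 : Vec n) 1 × Set.Ioi (0 : ℝ) =>
      f ((p.2 : ℝ) • (p.1 : Vec n)) := by fun_prop
  calc ∫⁻ x, f x = ∫⁻ x in ({0}ᶜ : Set (Vec n)), f x := by rw [restrict_compl_singleton]
    _ = ∫⁻ x : ({0}ᶜ : Set (Vec n)), f x ∂(volume.comap Subtype.val) :=
        (lintegral_subtype_comap (measurableSet_singleton _).compl f).symm
    _ = ∫⁻ p, f ((p.2 : ℝ) • (p.1 : Vec n)) ∂((volume : Measure (Vec n)).toSphere.prod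
          (Measure.volumeIoiPow (n - 1))) := by
        have h2 := hmp.lintegral_comp hg
        simp only [finrank_euclideanSpace, Fintype.card_fin] at h2
        rw [← h2]
        refine lintegral_congr fun x => ?_
        have hx : ‖(x : Vec n)‖ ≠ 0 := norm_ne_zero_iff.2 x.2
        simp [homeomorphUnitSphereProd_apply_snd_coe, homeomorphUnitSphereProd_apply_fst_coe,
          smul_smul, hx]
    _ = _ := by
        rw [lintegral_prod _ hg.aemeasurable]
        refine lintegral_congr fun s => ?_
        have h1 : Measurable fun r : Set.Ioi (0 : ℝ) => f ((r : ℝ) • (s : Vec n)) := by fun_prop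
        rw [Measure.volumeIoiPow, lintegral_withDensity_eq_lintegral_mul _ (by fun_prop) h1]
        exact lintegral_subtype_comap measurableSet_Ioi
          (fun r : ℝ => ENNReal.ofReal (r ^ (n - 1)) * f (r • (s : Vec n)))

lemma toSphere_univ_ne_zero (hn : n ≠ 0) :
    (volume : Measure (Vec n)).toSphere Set.univ ≠ 0 := by
  have : NeZero n := ⟨hn⟩
  exact Measure.measure_univ_ne_zero.2 (Measure.toSphere_ne_zero _)

lemma isProbabilityMeasure_powerShell (hn : n ≠ 0) (P : ℝ) :
    IsProbabilityMeasure (powerShell n P) := by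
  have h : IsProbabilityMeasure (((volume : Measure (Vec n)).toSphere Set.univ)⁻¹ •
      (volume : Measure (Vec n)).toSphere) :=
    ⟨by simpa using ENNReal.inv_mul_cancel (toSphere_univ_ne_zero hn) (measure_ne_top _ _)⟩
  exact Measure.isProbabilityMeasure_map (by fun_prop)

lemma lintegral_powerShell (P : ℝ) {f : Vec n → ENNReal} (hf : Measurable f) :
    ∫⁻ x, f x ∂(powerShell n P) = ((volume : Measure (Vec n)).toSphere Set.univ)⁻¹ *
      ∫⁻ s, f (Real.sqrt (n * P) • (s : Vec n)) ∂(volume : Measure (Vec n)).toSphere := by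
  rw [powerShell, lintegral_map hf (by fun_prop), lintegral_smul_measure, smul_eq_mul]

/-! ### The radial profile of a Gaussian distribution -/

/-- The unnormalised density of the norm of a `𝒩(0, P Iₙ)` random vector. -/
noncomputable def radialWeight (n : ℕ) (P r : ℝ) : ℝ := r ^ (n - 1) * Real.exp (-r ^ 2 / (2 * P))

lemma radialWeight_pos (n : ℕ) (P : ℝ) {r : ℝ} (hr : 0 < r) : 0 < radialWeight n P r := by
  unfold radialWeight; positivity

/-- Around `√(n P)` the radial weight is dominated by a Gaussian profile whose width does not depend
on `n`. The factor `exp 1` pays for `√(n P)` not being the exact mode, which is `√((n - 1) P)`. -/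
lemma radialWeight_le (hn : n ≠ 0) {P r : ℝ} (hP : 0 < P) (hr : 0 ≤ r) :
    radialWeight n P r ≤ radialWeight n P √(n * P) *
      Real.exp (1 - (r - √(n * P)) ^ 2 / (2 * P)) := by
  have hn0 : (0 : ℝ) < n := by positivity
  have hR : 0 < √(n * P) := by positivity
  have hR2 : √(n * P) ^ 2 = n * P := Real.sq_sqrt (by positivity)
  set R := √(n * P)
  have h1 : r ^ (n - 1) ≤ R ^ (n - 1) * Real.exp ((n - 1 : ℕ) * (r / R - 1)) := by
    have : r / R ≤ Real.exp (r / R - 1) := by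
      linarith [Real.add_one_le_exp (r / R - 1)]
    calc r ^ (n - 1) = R ^ (n - 1) * (r / R) ^ (n - 1) := by
          rw [← mul_pow]; field_simp
      _ ≤ R ^ (n - 1) * Real.exp (r / R - 1) ^ (n - 1) := by gcongr
      _ = _ := by rw [← Real.exp_nat_mul]
  unfold radialWeight
  calc r ^ (n - 1) * Real.exp (-r ^ 2 / (2 * P))
      ≤ R ^ (n - 1) * Real.exp ((n - 1 : ℕ) * (r / R - 1)) * Real.exp (-r ^ 2 / (2 * P)) := by
        gcongr
    _ ≤ R ^ (n - 1) * (Real.exp (-R ^ 2 / (2 * P)) *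
          Real.exp (1 - (r - R) ^ 2 / (2 * P))) := by
        rw [mul_assoc, ← Real.exp_add, ← Real.exp_add]
        refine mul_le_mul_of_nonneg_left (Real.exp_le_exp.2 ?_) (by positivity)
        rw [Nat.cast_sub (Nat.one_le_iff_ne_zero.2 hn), Nat.cast_one]
        -- `R² = n P` cancels the terms of order `√n` in the exponents.
        have hP' : P = R ^ 2 / n := by rw [hR2]; field_simp
        have e : (-R ^ 2 / (2 * P) + (1 - (r - R) ^ 2 / (2 * P))) -
            (((n : ℝ) - 1) * (r / R - 1) + -r ^ 2 / (2 * P)) = r / R := by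
          rw [hP']; field_simp; ring
        have : 0 ≤ r / R := by positivity
        linarith
    _ = _ := by ring

lemma exp_sub_two_mul_sq_le {u : ℝ} (hu : -(1 / 2) ≤ u) : Real.exp (u - 2 * u ^ 2) ≤ 1 + u := by
  have h0 : 0 < 1 + u := by linarith
  rw [← Real.le_log_iff_exp_le h0]
  refine le_trans ?_ (Real.one_sub_inv_le_log_of_pos h0)
  rw [show 1 - (1 + u)⁻¹ = u / (1 + u) by field_simp; ring, le_div_iff₀ h0]
  nlinarith [mul_nonneg (sq_nonneg u) (by linarith : 0 ≤ 1 + 2 * u)]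

/-- On the unit neighbourhood of `√(n P)` the radial weight loses at most a factor independent of
`n`. -/
lemma le_radialWeight (hn : n ≠ 0) {P t : ℝ} (hP : 0 < P) (hR : 2 ≤ √(n * P)) (ht : |t| ≤ 1) :
    radialWeight n P √(n * P) * Real.exp (-(1 + 5 / (2 * P))) ≤
      radialWeight n P (√(n * P) + t) := by
  have hn0 : (0 : ℝ) < n := by positivity
  have hR2 : √(n * P) ^ 2 = n * P := Real.sq_sqrt (by positivity)
  set R := √(n * P)
  have hR0 : 0 < R := by linarith
  obtain ⟨ht1, ht2⟩ := abs_le.1 ht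
  have hu : -(1 / 2) ≤ t / R := by
    rw [le_div_iff₀ hR0]; linarith
  have h1 : R ^ (n - 1) * Real.exp ((n - 1 : ℕ) * (t / R - 2 * (t / R) ^ 2)) ≤
      (R + t) ^ (n - 1) := by
    calc _ = R ^ (n - 1) * Real.exp (t / R - 2 * (t / R) ^ 2) ^ (n - 1) := by
          rw [← Real.exp_nat_mul]
      _ ≤ R ^ (n - 1) * (1 + t / R) ^ (n - 1) := by
          gcongr; exact exp_sub_two_mul_sq_le hu
      _ = _ := by rw [← mul_pow]; field_simp
  unfold radialWeight
  calc R ^ (n - 1) * Real.exp (-R ^ 2 / (2 * P)) * Real.exp (-(1 + 5 / (2 * P)))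
      ≤ R ^ (n - 1) * (Real.exp ((n - 1 : ℕ) * (t / R - 2 * (t / R) ^ 2)) *
          Real.exp (-(R + t) ^ 2 / (2 * P))) := by
        rw [mul_assoc, ← Real.exp_add, ← Real.exp_add]
        refine mul_le_mul_of_nonneg_left (Real.exp_le_exp.2 ?_) (by positivity)
        rw [Nat.cast_sub (Nat.one_le_iff_ne_zero.2 hn), Nat.cast_one]
        have hP' : P = R ^ 2 / n := by rw [hR2]; field_simp
        have e : (((n : ℝ) - 1) * (t / R - 2 * (t / R) ^ 2) + -(R + t) ^ 2 / (2 * P)) -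
            (-R ^ 2 / (2 * P) + -(1 + 5 / (2 * P))) =
            (1 - t / R) + 2 * (t / R) ^ 2 + 5 / (2 * P) * (1 - t ^ 2) := by
          rw [hP']; field_simp; ring
        have h2 : t / R ≤ 1 := by rw [div_le_one hR0]; linarith
        have h3 : t ^ 2 ≤ 1 := by rw [← sq_abs]; nlinarith [abs_nonneg t]
        have h4 : 0 ≤ 5 / (2 * P) * (1 - t ^ 2) := mul_nonneg (by positivity) (by linarith)
        nlinarith [sq_nonneg (t / R)]
    _ ≤ _ := by rw [← mul_assoc]; gcongr

lemma lintegral_radialWeight_le (hn : n ≠ 0) {P : ℝ} (hP : 0 < P) :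
    ∫⁻ r in Set.Ioi (0 : ℝ), ENNReal.ofReal (radialWeight n P r) ≤
      ENNReal.ofReal (radialWeight n P √(n * P) * (Real.exp 1 * √(2 * Real.pi * P))) := by
  have hn0 : (0 : ℝ) < n := by positivity
  have hR : 0 < √(n * P) := by positivity
  set R := √(n * P)
  have e : ∀ r : ℝ, Real.exp (1 - (r - R) ^ 2 / (2 * P)) =
      Real.exp 1 * Real.exp (-(1 / (2 * P)) * (r - R) ^ 2) := by
    intro r; rw [← Real.exp_add]; congr 1; ring
  have hint : Integrable fun r : ℝ => Real.exp (-(1 / (2 * P)) * (r - R) ^ 2) :=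
    (integrable_exp_neg_mul_sq (b := 1 / (2 * P)) (by positivity)).comp_sub_right R
  have hval : ∫ r : ℝ, Real.exp (-(1 / (2 * P)) * (r - R) ^ 2) = √(2 * Real.pi * P) := by
    rw [integral_sub_right_eq_self (fun r : ℝ => Real.exp (-(1 / (2 * P)) * r ^ 2)) R,
      integral_gaussian]
    congr 1; field_simp
  have hw := (radialWeight_pos n P hR).le
  calc ∫⁻ r in Set.Ioi (0 : ℝ), ENNReal.ofReal (radialWeight n P r)
      ≤ ∫⁻ r in Set.Ioi (0 : ℝ), ENNReal.ofReal (radialWeight n P R *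
          (Real.exp 1 * Real.exp (-(1 / (2 * P)) * (r - R) ^ 2))) := by
        refine setLIntegral_mono' measurableSet_Ioi fun r hr => ENNReal.ofReal_le_ofReal ?_
        rw [← e]
        exact radialWeight_le hn hP (le_of_lt hr)
    _ ≤ ∫⁻ r : ℝ, ENNReal.ofReal (radialWeight n P R *
          (Real.exp 1 * Real.exp (-(1 / (2 * P)) * (r - R) ^ 2))) := setLIntegral_le_lintegral _ _
    _ = _ := by
        rw [← ofReal_integral_eq_lintegral_ofReal ((hint.const_mul _).const_mul _)
          (ae_of_all _ fun r => by positivity), integral_const_mul, integral_const_mul, hval]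

/-! ### Comparison of the smoothed shell with a Gaussian distribution -/

/-- The integral over `[R - 1, R + 1]` is bounded below by pairing the opposite points `R + t` and
`R - t`. -/
lemma le_setLIntegral_Ioi_of_le_add {h : ℝ → ENNReal} (hh : Measurable h) {R : ℝ} (hR : 1 < R)
    {c : ENNReal} (hc : ∀ t ∈ Set.Icc (-1 : ℝ) 1, c ≤ h (R + t) + h (R - t)) :
    c ≤ ∫⁻ r in Set.Ioi (0 : ℝ), h r := by
  set F : ℝ → ENNReal := (Set.Icc (-1 : ℝ) 1).indicator fun t => h (R + t) with hF
  have hFm : Measurable F := Measurable.indicator (by fun_prop) measurableSet_Icc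
  have h1 : ∫⁻ t, F t ≤ ∫⁻ r in Set.Ioi (0 : ℝ), h r := by
    calc ∫⁻ t, F t ≤ ∫⁻ t, (Set.Ioi (0 : ℝ)).indicator h (R + t) := by
          refine lintegral_mono fun t => ?_
          by_cases ht : t ∈ Set.Icc (-1 : ℝ) 1
          · rw [hF, Set.indicator_of_mem ht, Set.indicator_of_mem]
            exact Set.mem_Ioi.2 (by linarith [ht.1])
          · simp [hF, Set.indicator_of_notMem ht]
      _ = ∫⁻ r, (Set.Ioi (0 : ℝ)).indicator h r :=
          lintegral_add_left_eq_self ((Set.Ioi (0 : ℝ)).indicator h) R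
      _ = _ := lintegral_indicator measurableSet_Ioi h
  have h2 : 2 * c ≤ 2 * ∫⁻ t, F t := by
    calc 2 * c = ∫⁻ _ in Set.Icc (-1 : ℝ) 1, c := by
          rw [setLIntegral_const, Real.volume_Icc, mul_comm]; norm_num
      _ = ∫⁻ t, (Set.Icc (-1 : ℝ) 1).indicator (fun _ => c) t :=
          (lintegral_indicator measurableSet_Icc _).symm
      _ ≤ ∫⁻ t, (F t + F (-t)) := by
          refine lintegral_mono fun t => ?_
          by_cases ht : t ∈ Set.Icc (-1 : ℝ) 1
          · have ht' : -t ∈ Set.Icc (-1 : ℝ) 1 := ⟨by linarith [ht.2], by linarith [ht.1]⟩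
            simp only [hF, Set.indicator_of_mem ht, Set.indicator_of_mem ht', ← sub_eq_add_neg]
            exact hc t ht
          · simp [Set.indicator_of_notMem ht]
      _ = 2 * ∫⁻ t, F t := by
          rw [lintegral_add_left hFm, lintegral_neg_eq_self F, two_mul]
  exact ((ENNReal.mul_le_mul_iff_right (by norm_num) (by norm_num)).1 h2).trans h1

/-- The parallelogram law turns the densities at centres `x ± w` into a common factor times
`exp (± ⟪y - x, w⟫ / v)`, and these two exponentials sum to at least `2`. The bound is uniform in
`y`, which no bound on the density at a single one of the centres `x ± w` could be. -/
lemma gaussianDensity_midpoint_le {v : ℝ} (hv : 0 < v) (x w y : Vec n) (hw : ‖w‖ ≤ 1) :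
    2 * Real.exp (-(1 / (2 * v))) * gaussianDensity x v y ≤
      gaussianDensity (x + w) v y + gaussianDensity (x - w) v y := by
  unfold gaussianDensity
  have h1 : ‖y - (x + w)‖ ^ 2 = ‖y - x‖ ^ 2 - 2 * inner ℝ (y - x) w + ‖w‖ ^ 2 := by
    rw [← sub_sub, norm_sub_sq_real]
  have h2 : ‖y - (x - w)‖ ^ 2 = ‖y - x‖ ^ 2 + 2 * inner ℝ (y - x) w + ‖w‖ ^ 2 := by
    rw [← sub_add, norm_add_sq_real]
  rw [h1, h2]
  set A := ‖y - x‖ ^ 2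
  set I : ℝ := inner ℝ (y - x) w
  have hw2 : ‖w‖ ^ 2 / (2 * v) ≤ 1 / (2 * v) := by
    gcongr; nlinarith [norm_nonneg w]
  rw [show -(A - 2 * I + ‖w‖ ^ 2) / (2 * v) = -A / (2 * v) + -(‖w‖ ^ 2 / (2 * v)) + I / v by
      field_simp; ring,
    show -(A + 2 * I + ‖w‖ ^ 2) / (2 * v) = -A / (2 * v) + -(‖w‖ ^ 2 / (2 * v)) + -(I / v) by
      field_simp; ring]
  simp only [Real.exp_add]
  have hcosh : 2 ≤ Real.exp (I / v) + Real.exp (-(I / v)) := by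
    linarith [Real.add_one_le_exp (I / v), Real.add_one_le_exp (-(I / v))]
  have hexp : Real.exp (-(1 / (2 * v))) ≤ Real.exp (-(‖w‖ ^ 2 / (2 * v))) :=
    Real.exp_le_exp.2 (by linarith)
  have hC : 0 ≤ (2 * Real.pi * v) ^ (-(n : ℝ) / 2) * Real.exp (-A / (2 * v)) := by positivity
  calc 2 * Real.exp (-(1 / (2 * v))) * ((2 * Real.pi * v) ^ (-(n : ℝ) / 2) * Real.exp (-A / (2 * v)))
      = (2 * Real.pi * v) ^ (-(n : ℝ) / 2) * Real.exp (-A / (2 * v)) *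
          (Real.exp (-(1 / (2 * v))) * 2) := by ring
    _ ≤ (2 * Real.pi * v) ^ (-(n : ℝ) / 2) * Real.exp (-A / (2 * v)) *
          (Real.exp (-(‖w‖ ^ 2 / (2 * v))) * (Real.exp (I / v) + Real.exp (-(I / v)))) := by
        gcongr
    _ = _ := by ring

/-- The density of a power shell smoothed by Gaussian noise is at most a constant times the density
of the Gaussian distribution with the same second moment, uniformly in `y` and in large `n`. -/
lemma exists_lintegral_powerShell_le {P v : ℝ} (hP : 0 < P) (hv : 0 < v) :
    ∃ K : ℝ, 0 < K ∧ ∀ᶠ n : ℕ in atTop, ∀ y : Vec n,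
      ∫⁻ x, ENNReal.ofReal (gaussianDensity x v y) ∂(powerShell n P) ≤
        ENNReal.ofReal (K * gaussianDensity 0 (v + P) y) := by
  obtain ⟨U, hU⟩ : ∃ U, U = Real.exp 1 * √(2 * Real.pi * P) := ⟨_, rfl⟩
  obtain ⟨L, hL⟩ : ∃ L, L = Real.exp (-(1 + 5 / (2 * P))) * (2 * Real.exp (-(1 / (2 * v)))) :=
    ⟨_, rfl⟩
  have hU0 : 0 < U := by rw [hU]; positivity
  have hL0 : 0 < L := by rw [hL]; positivity
  refine ⟨U / L, by positivity, ?_⟩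
  -- `n ≥ 4 / P` makes the radius `√(n P)` at least `2`, as `le_radialWeight` requires.
  have hlarge : ∀ᶠ n : ℕ in atTop, 4 / P ≤ (n : ℝ) :=
    tendsto_natCast_atTop_atTop.eventually_ge_atTop _
  filter_upwards [hlarge, eventually_ne_atTop 0] with n hnP hn y
  have hR : 2 ≤ √(n * P) := by
    apply Real.le_sqrt_of_sq_le
    rw [div_le_iff₀ hP] at hnP
    linarith
  set R := √(n * P)
  set σ := (volume : Measure (Vec n)).toSphere
  set C := (2 * Real.pi * P) ^ (-(n : ℝ) / 2)
  have hC0 : 0 < C := by positivity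
  have hw0 : 0 < radialWeight n P R := radialWeight_pos n P (by linarith)
  have hγ : ∀ (s : Metric.sphere (0 : Vec n) 1) (r : ℝ), 0 < r →
      ENNReal.ofReal (r ^ (n - 1)) * ENNReal.ofReal (gaussianDensity 0 P (r • (s : Vec n))) =
        ENNReal.ofReal (C * radialWeight n P r) := by
    intro s r hr
    rw [← ENNReal.ofReal_mul (by positivity)]
    congr 1
    rw [gaussianDensity, radialWeight, sub_zero, norm_smul, norm_eq_of_mem_sphere s, mul_one,
      Real.norm_eq_abs, sq_abs]
    ring
  have hmeas : ∀ y : Vec n, Measurable fun x : Vec n =>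
      ENNReal.ofReal (gaussianDensity x v y) := fun y => by fun_prop
  have hmeas0 : Measurable fun x : Vec n => ENNReal.ofReal (gaussianDensity 0 P x) := by fun_prop
  -- The radial density of `𝒩(0, P Iₙ)` at the shell radius is bounded below: the total mass `1` is
  -- at most a constant multiple of it.
  have hupper : 1 ≤ ENNReal.ofReal (C * radialWeight n P R * U) * σ Set.univ := by
    rw [← lintegral_gaussianDensity (0 : Vec n) hP, lintegral_eq_lintegral_toSphere hn hmeas0,
      ← lintegral_const]
    refine lintegral_mono fun s => ?_
    rw [setLIntegral_congr_fun measurableSet_Ioi fun r hr => hγ s r hr]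
    simp_rw [ENNReal.ofReal_mul hC0.le, mul_assoc C, ENNReal.ofReal_mul hC0.le]
    rw [lintegral_const_mul' _ _ ENNReal.ofReal_ne_top]
    gcongr
    rw [hU]
    exact lintegral_radialWeight_le hn hP
  have hmul : Measurable fun x : Vec n => ENNReal.ofReal (gaussianDensity 0 P x) *
      ENNReal.ofReal (gaussianDensity x v y) := hmeas0.mul (hmeas y)
  -- The smoothed `𝒩(0, P Iₙ)` dominates the contribution of the radii `R + t`, `|t| ≤ 1`, in its
  -- polar decomposition.
  have hlower : ENNReal.ofReal (C * radialWeight n P R * L) *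
      ∫⁻ s, ENNReal.ofReal (gaussianDensity (R • (s : Vec n)) v y) ∂σ ≤
        ENNReal.ofReal (gaussianDensity 0 (v + P) y) := by
    rw [← lintegral_gaussianDensity_mul hP hv y,
      lintegral_eq_lintegral_toSphere hn hmul,
      ← lintegral_const_mul' _ _ ENNReal.ofReal_ne_top]
    refine lintegral_mono fun s => ?_
    have hs : Measurable fun r : ℝ => ENNReal.ofReal (C * radialWeight n P r) *
        ENNReal.ofReal (gaussianDensity (r • (s : Vec n)) v y) :=
      Measurable.mul (by unfold radialWeight; fun_prop)
        ((hmeas y).comp (measurable_id.smul_const _))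
    simp_rw [← mul_assoc]
    rw [setLIntegral_congr_fun measurableSet_Ioi (g := fun r : ℝ =>
      ENNReal.ofReal (C * radialWeight n P r) *
        ENNReal.ofReal (gaussianDensity (r • (s : Vec n)) v y))
      fun r hr => by simp only [hγ s r hr]]
    refine le_setLIntegral_Ioi_of_le_add hs (R := R) (by linarith) fun t ht => ?_
    have ht' : |t| ≤ 1 := abs_le.2 ht
    have hp := le_radialWeight hn hP hR ht'
    have hm := le_radialWeight hn hP hR (t := -t) (by simpa using ht')
    rw [← sub_eq_add_neg] at hm
    have hrp : 0 < R + t := by linarith [ht.1]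
    have hrm : 0 < R - t := by linarith [ht.2]
    have hd1 := (gaussianDensity_pos ((R + t) • (s : Vec n)) hv y).le
    have hd2 := (gaussianDensity_pos ((R - t) • (s : Vec n)) hv y).le
    have hp0 := (radialWeight_pos n P hrp).le
    have hm0 := (radialWeight_pos n P hrm).le
    have hmid := gaussianDensity_midpoint_le hv (R • (s : Vec n)) (t • (s : Vec n)) y
      (by rw [norm_smul, norm_eq_of_mem_sphere s, mul_one]; exact ht')
    rw [← add_smul, ← sub_smul] at hmid
    rw [← ENNReal.ofReal_mul (by positivity), ← ENNReal.ofReal_mul (by positivity),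
      ← ENNReal.ofReal_mul (by positivity), ← ENNReal.ofReal_add (by positivity) (by positivity)]
    refine ENNReal.ofReal_le_ofReal ?_
    calc C * radialWeight n P R * L * gaussianDensity (R • (s : Vec n)) v y
        = C * (radialWeight n P R * Real.exp (-(1 + 5 / (2 * P)))) *
          (2 * Real.exp (-(1 / (2 * v))) * gaussianDensity (R • (s : Vec n)) v y) := by
          rw [hL]; ring
      _ ≤ C * (radialWeight n P R * Real.exp (-(1 + 5 / (2 * P)))) *
          (gaussianDensity ((R + t) • (s : Vec n)) v y +
            gaussianDensity ((R - t) • (s : Vec n)) v y) := by gcongr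
      _ = C * (radialWeight n P R * Real.exp (-(1 + 5 / (2 * P)))) *
            gaussianDensity ((R + t) • (s : Vec n)) v y +
          C * (radialWeight n P R * Real.exp (-(1 + 5 / (2 * P)))) *
            gaussianDensity ((R - t) • (s : Vec n)) v y := by ring
      _ ≤ _ := by gcongr
  have hσ0 : σ Set.univ ≠ 0 := toSphere_univ_ne_zero hn
  have hσt : σ Set.univ ≠ ⊤ := measure_ne_top _ _
  rw [lintegral_powerShell P (hmeas y)]
  set S := ∫⁻ s, ENNReal.ofReal (gaussianDensity (R • (s : Vec n)) v y) ∂σ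
  calc (σ Set.univ)⁻¹ * S
      ≤ (ENNReal.ofReal (C * radialWeight n P R * U) * σ Set.univ) * ((σ Set.univ)⁻¹ * S) :=
        le_mul_of_one_le_left' hupper
    _ = ENNReal.ofReal (C * radialWeight n P R * U) * S := by
        rw [mul_assoc, ← mul_assoc (σ Set.univ), ENNReal.mul_inv_cancel hσ0 hσt, one_mul]
    _ = ENNReal.ofReal (U / L) * (ENNReal.ofReal (C * radialWeight n P R * L) * S) := by
        rw [← mul_assoc, ← ENNReal.ofReal_mul (by positivity)]
        congr 2; field_simp
    _ ≤ ENNReal.ofReal (U / L) * ENNReal.ofReal (gaussianDensity 0 (v + P) y) := by gcongr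
    _ = _ := (ENNReal.ofReal_mul (by positivity)).symm

/-! ### Laws and Radon–Nikodym derivatives -/

lemma integrable_gaussianDensity_comp {α : Type*} [MeasurableSpace α] (μ : Measure α)
    [IsFiniteMeasure μ] {f : α → Vec n} (hf : Measurable f) {v : ℝ} (hv : 0 < v) (y : Vec n) :
    Integrable (fun a => gaussianDensity (f a) v y) μ := by
  refine .of_bound (by fun_prop : Measurable _).aestronglyMeasurable
    ((2 * Real.pi * v) ^ (-(n : ℝ) / 2)) (ae_of_all _ fun a => ?_)
  rw [Real.norm_of_nonneg (gaussianDensity_pos _ hv y).le]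
  exact gaussianDensity_le _ hv y

lemma ofReal_integral_gaussianDensity {α : Type*} [MeasurableSpace α] (μ : Measure α)
    [IsFiniteMeasure μ] {f : α → Vec n} (hf : Measurable f) {v : ℝ} (hv : 0 < v) (y : Vec n) :
    ENNReal.ofReal (∫ a, gaussianDensity (f a) v y ∂μ) =
      ∫⁻ a, ENNReal.ofReal (gaussianDensity (f a) v y) ∂μ :=
  ofReal_integral_eq_lintegral_ofReal (integrable_gaussianDensity_comp μ hf hv y)
    (ae_of_all _ fun _ => (gaussianDensity_pos _ hv y).le)

/-- The law of `f(A) + Z`, with `Z ∼ 𝒩(0, v Iₙ)` independent of `A ∼ μ`, is the mixture of the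
`𝒩(f(a), v Iₙ)`. -/
lemma map_add_gaussianLaw {α : Type*} [MeasurableSpace α] (μ : Measure α)
    [IsFiniteMeasure μ] {f : α → Vec n} (hf : Measurable f) {v : ℝ} (hv : 0 < v) :
    (μ.prod (gaussianLaw 0 v)).map (fun p => f p.1 + p.2) =
      volume.withDensity fun y => ENNReal.ofReal (∫ a, gaussianDensity (f a) v y ∂μ) := by
  have hadd : Measurable fun p : α × Vec n => f p.1 + p.2 := by fun_prop
  rw [gaussianLaw_eq_withDensity _ hv]
  refine Measure.ext fun s hs => ?_
  rw [withDensity_apply _ hs, Measure.map_apply hadd hs,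
    ← lintegral_indicator_one (hadd hs), lintegral_prod _
      ((measurable_one.indicator (hadd hs)).aemeasurable)]
  simp_rw [ofReal_integral_gaussianDensity μ hf hv]
  have hswap : Measurable
      (Function.uncurry fun y a => ENNReal.ofReal (gaussianDensity (f a) v y)) := by
    unfold Function.uncurry
    fun_prop
  rw [lintegral_lintegral_swap hswap.aemeasurable]
  refine lintegral_congr fun a => ?_
  have hgs : ∀ m : Vec n, Measurable fun x => ENNReal.ofReal (gaussianDensity m v x) :=
    fun m => by fun_prop
  have hpre : Measurable fun z : Vec n =>
      ((fun p : α × Vec n => f p.1 + p.2) ⁻¹' s).indicator (1 : α × Vec n → ENNReal) (a, z) :=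
    (measurable_one.indicator (hadd hs)).comp measurable_prodMk_left
  rw [lintegral_withDensity_eq_lintegral_mul _ (hgs 0) hpre, ← lintegral_indicator hs,
    ← lintegral_sub_right_eq_self _ (f a)]
  refine lintegral_congr fun y => ?_
  simp only [Pi.mul_apply, gaussianDensity_sub, zero_add]
  by_cases hy : y ∈ s <;> simp [Set.indicator, hy]

/-- A law with density `p` with respect to Lebesgue measure has Radon–Nikodym derivative `p / q`
with respect to a Gaussian law with density `q`. -/
lemma derivBoundedBy_of_withDensity {p : Vec n → ℝ} (hp : Measurable p) (m : Vec n)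
    {v : ℝ} (hv : 0 < v) {μ : Measure (Vec n)}
    (hμ : μ = volume.withDensity fun y => ENNReal.ofReal (p y)) {K : ℝ}
    (hK : ∀ y, p y ≤ K * gaussianDensity m v y) :
    DerivBoundedBy μ (gaussianLaw m v) (fun y => p y / gaussianDensity m v y) K := by
  have hq : Measurable fun x => gaussianDensity m v x := by fun_prop
  have hd : Measurable fun y => ENNReal.ofReal (p y / gaussianDensity m v y) :=
    (hp.div hq).ennreal_ofReal
  have h : μ = (gaussianLaw m v).withDensity
      fun y => ENNReal.ofReal (p y / gaussianDensity m v y) := by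
    rw [hμ, gaussianLaw_eq_withDensity m hv, ← withDensity_mul _ hq.ennreal_ofReal hd]
    congr 1
    ext y
    have hqy := gaussianDensity_pos m hv y
    rw [Pi.mul_apply, ← ENNReal.ofReal_mul hqy.le, mul_div_cancel₀ _ hqy.ne']
  have : IsFiniteMeasure (gaussianLaw m v) := by unfold gaussianLaw; infer_instance
  refine ⟨?_, ?_, fun y => (div_le_iff₀ (gaussianDensity_pos m hv y)).2 (hK y)⟩
  · rw [h]
    exact withDensity_absolutelyContinuous (gaussianLaw m v) _
  · rw [h]
    exact Measure.rnDeriv_withDensity (gaussianLaw m v) hd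

lemma measurable_integral_gaussianDensity {α : Type*} [MeasurableSpace α] (μ : Measure α)
    [SFinite μ] {f : α → Vec n} (hf : Measurable f) (v : ℝ) :
    Measurable fun y => ∫ a, gaussianDensity (f a) v y ∂μ := by
  have h : Measurable fun p : Vec n × α => gaussianDensity (f p.2) v p.1 := by fun_prop
  exact h.stronglyMeasurable.integral_prod_right.measurable

/-- Bochner-integral form of `exists_lintegral_powerShell_le`, for a shell centred at an arbitrary
point. -/
lemma exists_integral_powerShell_le {P v : ℝ} (hP : 0 < P) (hv : 0 < v) :
    ∃ K : ℝ, 0 < K ∧ ∀ᶠ n : ℕ in atTop, ∀ a y : Vec n,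
      ∫ x, gaussianDensity (x + a) v y ∂(powerShell n P) ≤ K * gaussianDensity a (v + P) y := by
  obtain ⟨K, hK, h⟩ := exists_lintegral_powerShell_le hP hv
  refine ⟨K, hK, ?_⟩
  filter_upwards [h, eventually_ne_atTop 0] with n hn hn0 a y
  have := isProbabilityMeasure_powerShell hn0 P
  have h1 := hn (y - a)
  rw [← ofReal_integral_gaussianDensity _ measurable_id' hv, ENNReal.ofReal_le_ofReal_iff
    (mul_pos hK (gaussianDensity_pos _ (add_pos hv hP) _)).le] at h1
  simpa only [gaussianDensity_sub, zero_add] using h1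

end GaussianMAC

open GaussianMAC

theorem proposition3 (P₁ P₂ : ℝ) (hP₁ : 0 < P₁) (hP₂ : 0 < P₂) :
    ∃ K₁ K₂ K₃ : ℝ, 0 < K₁ ∧ 0 < K₂ ∧ 0 < K₃ ∧ ∀ᶠ n : ℕ in atTop,
      (∀ x₂ : GaussianMAC.Vec n,
        GaussianMAC.DerivBoundedBy
          (GaussianMAC.outputLawGivenX₂ P₁ x₂)
          (GaussianMAC.gaussianLaw x₂ (1 + P₁))
          (fun y => GaussianMAC.outputDensityGivenX₂ P₁ x₂ y /
            GaussianMAC.gaussianDensity x₂ (1 + P₁) y) K₁) ∧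
      (∀ x₁ : GaussianMAC.Vec n,
        GaussianMAC.DerivBoundedBy
          (GaussianMAC.outputLawGivenX₁ P₂ x₁)
          (GaussianMAC.gaussianLaw x₁ (1 + P₂))
          (fun y => GaussianMAC.outputDensityGivenX₁ P₂ x₁ y /
            GaussianMAC.gaussianDensity x₁ (1 + P₂) y) K₂) ∧
      GaussianMAC.DerivBoundedBy
        (GaussianMAC.outputLaw n P₁ P₂)
        (GaussianMAC.gaussianLaw 0 (1 + P₁ + P₂))
        (fun y => GaussianMAC.outputDensity P₁ P₂ y /
          GaussianMAC.gaussianDensity 0 (1 + P₁ + P₂) y) K₃ := by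
  obtain ⟨K₁, hK₁, h₁⟩ := exists_integral_powerShell_le hP₁ one_pos
  obtain ⟨K₂, hK₂, h₂⟩ := exists_integral_powerShell_le hP₂ one_pos
  obtain ⟨K₃, hK₃, h₃⟩ := exists_integral_powerShell_le hP₁ (add_pos one_pos hP₂)
  refine ⟨K₁, K₂, K₂ * K₃, hK₁, hK₂, mul_pos hK₂ hK₃, ?_⟩
  filter_upwards [h₁, h₂, h₃, eventually_ne_atTop 0] with n h₁ h₂ h₃ hn
  have := isProbabilityMeasure_powerShell hn P₁
  have := isProbabilityMeasure_powerShell hn P₂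
  refine ⟨fun x₂ => ?_, fun x₁ => ?_, ?_⟩
  · have hf : Measurable fun x : Vec n => x + x₂ := by fun_prop
    exact derivBoundedBy_of_withDensity (measurable_integral_gaussianDensity _ hf 1) x₂
      (by positivity) (map_add_gaussianLaw (powerShell n P₁) hf one_pos) (h₁ x₂)
  · have hf : Measurable fun x : Vec n => x₁ + x := by fun_prop
    refine derivBoundedBy_of_withDensity (measurable_integral_gaussianDensity _ hf 1) x₁
      (by positivity) (map_add_gaussianLaw (powerShell n P₂) hf one_pos) fun y => ?_
    simpa only [add_comm x₁] using h₂ x₁ y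
  · have hf : Measurable fun x : Vec n × Vec n => x.1 + x.2 := by fun_prop
    have hprod : ∀ y : Vec n, outputDensity P₁ P₂ y = ∫ x : Vec n × Vec n,
        gaussianDensity (x.1 + x.2) 1 y ∂((powerShell n P₁).prod (powerShell n P₂)) :=
      fun y => (integral_prod _ (integrable_gaussianDensity_comp _ hf one_pos y)).symm
    have hmeas : Measurable (outputDensity P₁ P₂ : Vec n → ℝ) := by
      rw [funext hprod]
      exact measurable_integral_gaussianDensity _ hf 1
    refine derivBoundedBy_of_withDensity hmeas 0 (by positivity) ?_ fun y => ?_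
    · simp_rw [hprod]
      exact map_add_gaussianLaw ((powerShell n P₁).prod (powerShell n P₂)) hf one_pos
    -- `X₂ + Z` is dominated by `𝒩(0, (1 + P₂) Iₙ)`; this Gaussian then plays the role of the noise
    -- added to `X₁`.
    · calc outputDensity P₁ P₂ y
          ≤ ∫ x, K₂ * gaussianDensity x (1 + P₂) y ∂(powerShell n P₁) := by
            refine integral_mono (integrable_gaussianDensity_comp _ hf one_pos y).integral_prod_left
              ((integrable_gaussianDensity_comp _ measurable_id' (by positivity) y).const_mul _)
              fun x => ?_
            simpa only [channelDensity, add_comm x] using h₂ x y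
        _ = K₂ * ∫ x, gaussianDensity x (1 + P₂) y ∂(powerShell n P₁) := integral_const_mul _ _
        _ ≤ K₂ * (K₃ * gaussianDensity 0 (1 + P₂ + P₁) y) := by
            have := h₃ 0 y
            simp only [add_zero] at this
            gcongr
        _ = K₂ * K₃ * gaussianDensity 0 (1 + P₁ + P₂) y := by
            rw [mul_assoc, add_right_comm 1 P₁ P₂]
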